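/- Consider dual pivot quicksort on an input of $n$ distinct keys. If $n\le 1$ nothing is done. Otherwise the first and the last element are compared with each other and become the pivots $p<q$; each of the other $n-2$ elements is classified as small ($<p$), medium (between $p$ and $q$) or large ($>q$) by comparing it first with one of the two pivots and, if this does not decide its class, also with the other one; finally the three groups are sorted recursively. For each subarray length $n$ the order in which the elements are classified, and the choice of the pivot used first for each element, are given by a decision tree $T_n$: both may depend on the outcomes of the previous classifications. Elements are moved without further key comparisons, by any rule that depends only on the classification outcomes. Let $\mathrm{E}(C_n)$ be the average number of key comparisons over all $n!$ permutations of $\{1,\dots,n\}$. **Theorem.** Let $\mathit{sz}=\mathit{sz}(n)$ be $n^{2/3}$, rounded up or down to an integer. 1. Consider the following sampling strategy on each subarray of length $n$. First classify $\mathit{sz}$ elements (all $n-2$ of them if $\mathit{sz}> n-2$), with an arbitrary choice of the pivot used first. Let $s'$ and $\ell'$ be the number of small and large elements among them. If $s'<\ell'$, classify all remaining elements by comparing with $q$ first; otherwise compare all remaining elements with $p$ first. Then dual pivot quicksort with this strategy satisfies $$\mathrm{E}(C_n)=1.8\,n\ln n+o(n\ln n).$$ 2. This is asymptotically optimal: for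 every $\varepsilon>0$ there is $n_0$ such that for all $n\ge n_0$ and for every choice of decision trees $(T_k)_{k}$, dual pivot quicksort with these trees satisfies $\mathrm{E}(C_n)\ge(1.8-\varepsilon)\,n\ln n$. -/

import Mathlib

open Filter Asymptotics
open scoped Nat

namespace DualPivot

/-- The three possible classes of a non-pivot element with respect to the pivots `p < q`. -/
inductive Cls
  | small
  | medium
  | large
  deriving DecidableEq

/-- Which of the two pivots (`p` is the smaller one, `q` the larger one) is used in the first
comparison of an element. -/
inductive Pivot
  | p
  | q
  deriving DecidableEq

/-- A classification strategy for `k` elements: a three-way decision tree with `k` levels of inner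
nodes. A node with `k + 1` elements still unclassified carries the element to be classified next
(`i`, its position among the elements not yet classified on the path, in array order), the pivot
`l` with which this element is compared first, and one subtree for each outcome. Since `i` ranges
over the elements not yet classified, each element is classified exactly once on each path. -/
inductive DTree : ℕ → Type
  | leaf : DTree 0
  | node {k : ℕ} (i : Fin (k + 1)) (l : Pivot) (next : Cls → DTree k) : DTree (k + 1)

/-- Classify `x` with respect to the pivots `p < q`, first comparing with the pivot `l`; returns the
class of `x` and the number of key comparisons (`1` or `2`). The element is distinct from both
pivots. -/
def classify (l : Pivot) (p q x : ℕ) : Cls × ℕ :=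
  match l with
  | .p => if x < p then (.small, 1) else if x < q then (.medium, 2) else (.large, 2)
  | .q => if q < x then (.large, 1) else if p < x then (.medium, 2) else (.small, 2)

/-- Run a decision tree on the array `a` of the non-pivot elements; returns the classified elements
with their classes, in the order of inspection, and the total number of key comparisons. -/
def DTree.run (p q : ℕ) : {k : ℕ} → DTree k → (Fin k → ℕ) → List (Cls × ℕ) × ℕ
  | _, .leaf, _ => ([], 0)
  | _, .node i l next, a =>
    let r := classify l p q (a i)
    let t := (next r.1).run p q (i.removeNth a)
    ((r.1, a i) :: t.1, r.2 + t.2)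

theorem DTree.length_run (p q : ℕ) {k : ℕ} (T : DTree k) (a : Fin k → ℕ) :
    (T.run p q a).1.length = k := by
  induction T with
  | leaf => rfl
  | node i l next ih => simp [DTree.run, ih]

/-- A rule for moving elements around without key comparisons: given the sequence of all
classification outcomes of a partitioning step, it gives for each class the order in which the
`m` elements of that class are arranged in their subarray. -/
abbrev Arrangement := List Cls → Cls → (m : ℕ) → Equiv.Perm (Fin m)

/-- The subarray of all elements of class `c` produced by a partitioning step with trace `t`. -/
def group (ρ : Arrangement) (t : List (Cls × ℕ)) (c : Cls) : List ℕ :=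
  let g := (t.filter fun e => e.1 = c).map Prod.snd
  List.ofFn fun j => g.get (ρ (t.map Prod.fst) c g.length j)

theorem length_group_le (ρ : Arrangement) (t : List (Cls × ℕ)) (c : Cls) :
    (group ρ t c).length ≤ t.length := by
  simpa [group] using List.length_filter_le (fun e : Cls × ℕ => decide (e.1 = c)) t

/-- Dual pivot quicksort with a decision tree `T n` for each subarray length `n`. The first and
the last element are the pivots (one comparison decides which is the smaller one), the other
`n - 2` elements are classified by `T n`, and the three groups are sorted recursively.
Returns the sorted list and the number of key comparisons. -/
def quicksort (T : (n : ℕ) → DTree (n - 2)) (ρ : Arrangement) (xs : List ℕ) : List ℕ × ℕ :=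
  if h : xs.length < 2 then (xs, 0)
  else
    let x := xs[0]
    let y := xs[xs.length - 1]
    let p := min x y
    let q := max x y
    let r := (T xs.length).run p q fun j => xs[(j : ℕ) + 1]
    let A := quicksort T ρ (group ρ r.1 .small)
    let B := quicksort T ρ (group ρ r.1 .medium)
    let C := quicksort T ρ (group ρ r.1 .large)
    (A.1 ++ p :: (B.1 ++ q :: C.1), 1 + r.2 + A.2 + B.2 + C.2)
termination_by xs.length
decreasing_by
  all_goals
    refine lt_of_le_of_lt (length_group_le _ _ _) ?_
    rw [DTree.length_run]
    omega

/-- The average number of key comparisons of dual pivot quicksort on a uniformly random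
permutation of `{1, …, n}`. -/
noncomputable def averageComparisons (T : (n : ℕ) → DTree (n - 2)) (ρ : Arrangement)
    (n : ℕ) : ℝ :=
  (∑ π : Equiv.Perm (Fin n),
    ((quicksort T ρ (List.ofFn fun i => (π i : ℕ) + 1)).2 : ℝ)) / (n ! : ℝ)

/-- The pivot chosen after the outcomes `h` in the sample: `q` if fewer small than large elements
have been seen, and `p` otherwise. -/
def guess (h : List Cls) : Pivot :=
  if h.count .small < h.count .large then .q else .p

/-- `T.SamplesAfter sz h` says that the part `T` of a decision tree that is reached after the
outcomes `h` follows the sampling strategy with sample size `sz`: every node at which at least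
`sz` elements have already been classified is labelled with the pivot guessed from the first `sz`
outcomes. The labels within the sample are arbitrary. -/
def DTree.SamplesAfter (sz : ℕ) : {k : ℕ} → DTree k → List Cls → Prop
  | _, .leaf, _ => True
  | _, .node _ l next, h =>
    (sz ≤ h.length → l = guess (h.take sz)) ∧ ∀ c, (next c).SamplesAfter sz (h ++ [c])

end DualPivot

/-!
All that matters for the cost of a partitioning step is the word of classification outcomes. For a
uniformly random permutation, the decision tree only permutes the elements that are still to be
seen, so a word with `s` small, `m` medium and `l` large elements is produced by `2 s! m! l!`
permutations, whatever the tree (`sum_orders_word`). This is the law of a Pólya urn with three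
colours: after outcomes `h`, the next element has class `c` with probability
`(h.count c + 1) / (h.length + 3)`, and after `i` steps the triple of counts is uniform on all
triples of sum `i` (`triMean_step`).

Hence the expected cost of the next element is at least
`1 + (m + 1 + min s l + 1) / (s + m + l + 3)`, and the average of this quantity over all triples is
at least `3 / 2` and tends to `3 / 2`. This gives the lower bound `3 k / 2` for the cost of
classifying `k` elements with any tree (`le_mean`). For the sampling strategy, the class
probabilities of a Pólya urn are martingales, so once the pivot is fixed each remaining element has
the same expected cost as the first one after the sample (`mean_of_samplesAfter`), and this cost is
the above minimum at the end of the sample. As the sample size tends to infinity but is `o(n)`, a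
partitioning step costs `3 n / 2 + o(n)` (`mean_le`, `exists_sample_bound`).

Given the outcomes, the subarrays are again uniformly random (`sum_orders_subarray`): permuting the
elements of one class among themselves changes no outcome. So the average cost satisfies the usual
recurrence (`averageComparisons_add_two`). The function `(n + 1) H_n` solves it exactly for the
partitioning cost `(5 n + 17) / 6`, and the recurrence is monotone in that cost
(`le_of_sub_recursiveCost_le`), so a cost of `c n + o(n)` leads to `(6 / 5) c n ln n` up to lower
order terms; here `c = 3 / 2`.
-/

namespace DualPivot

/-! ### The Pólya urn of classification outcomes -/

instance : Fintype Cls :=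
  ⟨{.small, .medium, .large}, fun c => by cases c <;> decide⟩

theorem sum_cls {M : Type*} [AddCommMonoid M] (f : Cls → M) :
    ∑ c, f c = f .small + f .medium + f .large := by
  have : (Finset.univ : Finset Cls) = {.small, .medium, .large} := rfl
  rw [this, Finset.sum_insert (by decide), Finset.sum_insert (by decide), Finset.sum_singleton,
    add_assoc]

theorem prod_cls {M : Type*} [CommMonoid M] (f : Cls → M) :
    ∏ c, f c = f .small * f .medium * f .large := by
  have : (Finset.univ : Finset Cls) = {.small, .medium, .large} := rfl
  rw [this, Finset.prod_insert (by decide), Finset.prod_insert (by decide),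
    Finset.prod_singleton, mul_assoc]

/-- The number of comparisons needed to classify an element of class `c` when it is compared with
the pivot `l` first. -/
def comparisons : Pivot → Cls → ℕ
  | .p, .small => 1
  | .q, .large => 1
  | _, _ => 2

/-- The number of comparisons made by a decision tree on the path with outcomes `w`. -/
def DTree.cost : {k : ℕ} → DTree k → List Cls → ℕ
  | _, .leaf, _ => 0
  | _, .node _ _ _, [] => 0
  | _, .node _ l next, c :: w => comparisons l c + (next c).cost w

/-- The sum of `f w` over all words `w` of length `k` over the three classes. -/
def wordSum : ℕ → (List Cls → ℝ) → ℝ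
  | 0, f => f []
  | k + 1, f => ∑ c, wordSum k fun w => f (c :: w)

/-- The number of ways to fill the positions of the word `w` with the elements of the three
classes, once the pivots are known. -/
noncomputable def weight (w : List Cls) : ℝ := ∏ c, ((w.count c)! : ℝ)

/-- The expected number of comparisons made by a decision tree when the outcomes `h` precede it and
each outcome is drawn from the Pólya urn: after outcomes `h`, class `c` has
probability `(h.count c + 1) / (h.length + 3)`. -/
noncomputable def DTree.mean : {k : ℕ} → DTree k → List Cls → ℝ
  | _, .leaf, _ => 0
  | _, .node _ l next, h =>
    ∑ c, ((h.count c : ℝ) + 1) / (h.length + 3) * (comparisons l c + (next c).mean (h ++ [c]))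

theorem wordSum_add (k : ℕ) (f g : List Cls → ℝ) :
    wordSum k (fun w => f w + g w) = wordSum k f + wordSum k g := by
  induction k generalizing f g with
  | zero => rfl
  | succ k ih => simp only [wordSum, ih, Finset.sum_add_distrib]

theorem wordSum_mul_left (k : ℕ) (r : ℝ) (f : List Cls → ℝ) :
    wordSum k (fun w => r * f w) = r * wordSum k f := by
  induction k generalizing f with
  | zero => rfl
  | succ k ih => simp only [wordSum, ih, Finset.mul_sum]

theorem wordSum_sum {ι : Type*} (k : ℕ) (s : Finset ι) (f : ι → List Cls → ℝ) :
    wordSum k (fun w => ∑ i ∈ s, f i w) = ∑ i ∈ s, wordSum k (f i) := by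
  induction k generalizing f with
  | zero => rfl
  | succ k ih => simp only [wordSum, ih]; exact Finset.sum_comm

theorem wordSum_congr {k : ℕ} {f g : List Cls → ℝ} (h : ∀ w, w.length = k → f w = g w) :
    wordSum k f = wordSum k g := by
  induction k generalizing f g with
  | zero => exact h [] rfl
  | succ k ih =>
    exact Finset.sum_congr rfl fun c _ => ih fun w hw => h _ (by simp [hw])

theorem count_add_count_add_count (h : List Cls) :
    h.count .small + h.count .medium + h.count .large = h.length := by
  induction h with
  | nil => rfl
  | cons c h ih => cases c <;> (simp; omega)

theorem weight_concat (h : List Cls) (c : Cls) :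
    weight (h ++ [c]) = weight h * (h.count c + 1) := by
  cases c <;> simp [weight, prod_cls, List.count_append, Nat.factorial_succ] <;> ring

/-- Words that extend `h` by `k` letters have total weight
`weight h * (|h| + 3) (|h| + 4) ⋯ (|h| + k + 2)`. -/
theorem wordSum_weight_append (k : ℕ) (h : List Cls) :
    wordSum k (fun w => weight (h ++ w)) = weight h * ((h.length + k + 2)! / (h.length + 2)!) := by
  induction k generalizing h with
  | zero =>
    have : ((h.length + 2)! : ℝ) ≠ 0 := by positivity
    simp [wordSum, div_self this]
  | succ k ih =>
    have key (c : Cls) : wordSum k (fun w => weight (h ++ c :: w)) =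
        weight h * (h.count c + 1) * ((h.length + (k + 1) + 2)! / (h.length + 3)!) := by
      have := ih (h ++ [c])
      simp only [List.append_assoc, List.singleton_append, weight_concat, List.length_append,
        List.length_singleton] at this
      rw [this, show h.length + 1 + k + 2 = h.length + (k + 1) + 2 by ring]
    simp only [wordSum, key, sum_cls]
    have e : ((h.length + 3)! : ℝ) = (h.length + 3) * (h.length + 2)! := by
      rw [Nat.factorial_succ]; push_cast; ring
    have hc : (h.length : ℝ) = h.count .small + h.count .medium + h.count .large := by
      exact_mod_cast (count_add_count_add_count h).symm
    have h3 : (h.length + 3 : ℝ) ≠ 0 := by positivity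
    have h2 : ((h.length + 2)! : ℝ) ≠ 0 := by positivity
    rw [e]
    field_simp
    rw [hc]; ring

/-- The total cost of a tree over all words, weighted by the number of inputs that produce
each word, is its mean in the Pólya urn up to normalisation. -/
theorem wordSum_weight_mul_cost {k : ℕ} (T : DTree k) (h : List Cls) :
    wordSum k (fun w => weight (h ++ w) * T.cost w) =
      weight h * ((h.length + k + 2)! / (h.length + 2)!) * T.mean h := by
  induction T generalizing h with
  | leaf => simp [wordSum, DTree.cost, DTree.mean]
  | @node k i l next ih =>
    have key (c : Cls) : wordSum k (fun w => weight (h ++ c :: w) *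
          ((DTree.node i l next).cost (c :: w) : ℕ)) =
        weight h * (h.count c + 1) * ((h.length + (k + 1) + 2)! / (h.length + 3)!) *
          (comparisons l c + (next c).mean (h ++ [c])) := by
      have h1 := ih c (h ++ [c])
      have h2 := wordSum_weight_append k (h ++ [c])
      simp only [List.append_assoc, List.singleton_append, weight_concat, List.length_append,
        List.length_singleton] at h1 h2
      have e (w : List Cls) : weight (h ++ c :: w) * ((DTree.node i l next).cost (c :: w) : ℕ) =
          comparisons l c * weight (h ++ c :: w) + weight (h ++ c :: w) * (next c).cost w := by
        simp only [DTree.cost, Nat.cast_add]; ring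
      simp only [e, wordSum_add, wordSum_mul_left, h1, h2]
      rw [show h.length + 1 + k + 2 = h.length + (k + 1) + 2 by ring,
        show h.length + 1 + 2 = h.length + 3 by ring]
      ring
    simp only [wordSum, key, DTree.mean, Finset.mul_sum]
    refine Finset.sum_congr rfl fun c _ => ?_
    have e : ((h.length + 3)! : ℝ) = (h.length + 3) * (h.length + 2)! := by
      rw [Nat.factorial_succ]; push_cast; ring
    have h3 : (h.length + 3 : ℝ) ≠ 0 := by positivity
    have h2 : ((h.length + 2)! : ℝ) ≠ 0 := by positivity
    rw [e]
    field_simp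

/-! ### Bounds for the mean cost of a decision tree -/

/-- One step of the Pólya urn acting on functions of the numbers of small, medium and large
elements seen: the expected value of `g` after one more draw. -/
noncomputable def step (g : ℕ → ℕ → ℕ → ℝ) (s m l : ℕ) : ℝ :=
  ((s + 1) * g (s + 1) m l + (m + 1) * g s (m + 1) l + (l + 1) * g s m (l + 1)) /
    (s + m + l + 3)

/-- The expected number of comparisons for the next element if the pivot used first is the one
suggested by the numbers of small and large elements seen. -/
noncomputable def best (s m l : ℕ) : ℝ := 1 + ((m + 1) + (min s l + 1 : ℕ)) / (s + m + l + 3)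

/-- The expected sum of `best` along the next `k` steps of the urn. -/
noncomputable def bestSum : ℕ → ℕ → ℕ → ℕ → ℝ
  | 0 => fun _ _ _ => 0
  | k + 1 => fun s m l => best s m l + step (bestSum k) s m l

/-- A bound for the expected cost of classifying `k` more elements of which the first `j` belong to
the sample: sampled elements are charged the maximum of two comparisons, and the others the cost
`best` at the end of the sample. -/
noncomputable def sampleBound : ℕ → ℕ → ℕ → ℕ → ℕ → ℝ
  | 0, k => fun s m l => k * best s m l
  | _ + 1, 0 => fun _ _ _ => 0
  | j + 1, k + 1 => fun s m l => 2 + step (sampleBound j k) s m l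

theorem mean_node {k : ℕ} (i : Fin (k + 1)) (l : Pivot) (next : Cls → DTree k) (h : List Cls) :
    (DTree.node i l next).mean h =
      ((h.count .small + 1) * (comparisons l .small + (next .small).mean (h ++ [.small])) +
        (h.count .medium + 1) * (comparisons l .medium + (next .medium).mean (h ++ [.medium])) +
        (h.count .large + 1) * (comparisons l .large + (next .large).mean (h ++ [.large]))) /
      ((h.count .small : ℝ) + h.count .medium + h.count .large + 3) := by
  have hc : (h.length : ℝ) = h.count .small + h.count .medium + h.count .large := by
    exact_mod_cast (count_add_count_add_count h).symm
  rw [DTree.mean, sum_cls, hc]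
  ring

/-- Whatever the tree does, the next element costs at least `best` on average, since the urn, and
hence the law of the later outcomes, does not depend on the labels of the tree. -/
theorem bestSum_le_mean {k : ℕ} (T : DTree k) (h : List Cls) :
    bestSum k (h.count .small) (h.count .medium) (h.count .large) ≤ T.mean h := by
  induction T generalizing h with
  | leaf => exact le_rfl
  | @node k i l next ih =>
    have hs := ih .small (h ++ [.small])
    have hm := ih .medium (h ++ [.medium])
    have hl := ih .large (h ++ [.large])
    simp only [List.count_append, List.count_singleton] at hs hm hl
    simp only [beq_self_eq_true, ↓reduceIte, beq_iff_eq, reduceCtorEq, add_zero] at hs hm hl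
    rw [mean_node]
    simp only [bestSum, best, step]
    generalize h.count .small = s at *
    generalize h.count .medium = m at *
    generalize h.count .large = L at *
    have h0 : (0 : ℝ) < s + m + L + 3 := by positivity
    rw [add_assoc, ← add_div, ← sub_nonneg, ← sub_sub, sub_right_comm, ← sub_div,
      sub_nonneg, le_div_iff₀ h0]
    have h1 := mul_le_mul_of_nonneg_left hs (by positivity : (0 : ℝ) ≤ s + 1)
    have h2 := mul_le_mul_of_nonneg_left hm (by positivity : (0 : ℝ) ≤ m + 1)
    have h3 := mul_le_mul_of_nonneg_left hl (by positivity : (0 : ℝ) ≤ L + 1)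
    have h4 : ((min s L : ℕ) : ℝ) ≤ s := by exact_mod_cast min_le_left s L
    have h5 : ((min s L : ℕ) : ℝ) ≤ L := by exact_mod_cast min_le_right s L
    cases l <;> simp only [comparisons] <;> push_cast at * <;> nlinarith

/-- The expected number of comparisons for the next element if it is compared with `l` first. -/
noncomputable def nextMean (l : Pivot) (h : List Cls) : ℝ :=
  1 + ((h.count .medium + 1) + (h.count (match l with | .p => Cls.large | .q => Cls.small) + 1)) /
    (h.count .small + h.count .medium + h.count .large + 3 : ℝ)

/-- Once the sample is complete the pivot used first is fixed, and the expected cost of every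
remaining element is the same because the class probabilities in a Pólya urn are martingales. -/
theorem mean_of_samplesAfter {sz k : ℕ} (T : DTree k) (h : List Cls) (hT : T.SamplesAfter sz h)
    (hh : sz ≤ h.length) : T.mean h = k * nextMean (guess (h.take sz)) h := by
  induction T generalizing h with
  | leaf => simp [DTree.mean]
  | @node k i l next ih =>
    obtain ⟨hl, hn⟩ := hT
    have key (c : Cls) : (next c).mean (h ++ [c]) =
        k * nextMean (guess (h.take sz)) (h ++ [c]) := by
      rw [ih c _ (hn c) (by simp; omega), List.take_append_of_le_length hh]
    rw [mean_node, key, key, key, ← hl hh]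
    simp only [nextMean, List.count_append, List.count_singleton]
    have h0 : (0 : ℝ) < h.count .small + h.count .medium + h.count .large + 3 := by positivity
    have h1 : (0 : ℝ) < h.count .small + h.count .medium + h.count .large + 4 := by positivity
    cases l <;> simp [comparisons]
    all_goals
      generalize (h.count .small : ℝ) = s at *
      generalize (h.count .medium : ℝ) = m at *
      generalize (h.count .large : ℝ) = L at *
      rw [show (s + 1 + m + L + 3 : ℝ) = s + m + L + 4 by ring,
        show (s + (m + 1) + L + 3 : ℝ) = s + m + L + 4 by ring,
        show (s + m + (L + 1) + 3 : ℝ) = s + m + L + 4 by ring]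
      field_simp
      ring

theorem comparisons_le_two (l : Pivot) (c : Cls) : (comparisons l c : ℝ) ≤ 2 := by
  cases l <;> cases c <;> norm_num [comparisons]

/-- With the sampling strategy, the pivot fixed at the end of the sample is the cheaper one for the
next element, and by the martingale property also for all later ones. -/
theorem mean_le_sampleBound {sz k : ℕ} (T : DTree k) (h : List Cls) (hT : T.SamplesAfter sz h)
    (hh : h.length ≤ sz) :
    T.mean h ≤
      sampleBound (sz - h.length) k (h.count .small) (h.count .medium) (h.count .large) := by
  have full {k : ℕ} (T : DTree k) (h : List Cls) (hT : T.SamplesAfter sz h)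
      (he : h.length = sz) : T.mean h ≤
        sampleBound (sz - h.length) k (h.count .small) (h.count .medium) (h.count .large) := by
    rw [mean_of_samplesAfter T h hT he.ge, ← he, Nat.sub_self, List.take_length, sampleBound]
    refine mul_le_mul_of_nonneg_left (le_of_eq ?_) (Nat.cast_nonneg k)
    unfold nextMean guess best
    split_ifs with hg
    · simp [min_eq_left hg.le]
    · simp [min_eq_right (not_lt.1 hg)]
  induction T generalizing h with
  | leaf =>
    rcases hh.eq_or_lt with he | hlt
    · exact full _ h hT he
    · obtain ⟨j, hj⟩ : ∃ j, sz - h.length = j + 1 := ⟨sz - h.length - 1, by omega⟩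
      rw [hj]; exact le_rfl
  | @node k i l next ih =>
    rcases hh.eq_or_lt with he | hlt
    · exact full _ h hT he
    have hs := ih .small (h ++ [.small]) (hT.2 _) (by simp; omega)
    have hm := ih .medium (h ++ [.medium]) (hT.2 _) (by simp; omega)
    have hl := ih .large (h ++ [.large]) (hT.2 _) (by simp; omega)
    obtain ⟨j, hj⟩ : ∃ j, sz - h.length = j + 1 := ⟨sz - h.length - 1, by omega⟩
    have hj' : sz - (h.length + 1) = j := by omega
    simp only [List.count_append, List.count_singleton, List.length_append,
      List.length_singleton, hj'] at hs hm hl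
    simp only [beq_self_eq_true, ↓reduceIte, beq_iff_eq, reduceCtorEq, add_zero] at hs hm hl
    rw [mean_node, hj]
    simp only [sampleBound, step]
    generalize h.count .small = s at *
    generalize h.count .medium = m at *
    generalize h.count .large = L at *
    have h0 : (0 : ℝ) < s + m + L + 3 := by positivity
    rw [div_le_iff₀ h0, add_mul (2 : ℝ), div_mul_cancel₀ _ h0.ne']
    have h1 := mul_le_mul_of_nonneg_left (add_le_add (comparisons_le_two l .small) hs)
      (by positivity : (0 : ℝ) ≤ s + 1)
    have h2 := mul_le_mul_of_nonneg_left (add_le_add (comparisons_le_two l .medium) hm)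
      (by positivity : (0 : ℝ) ≤ m + 1)
    have h3 := mul_le_mul_of_nonneg_left (add_le_add (comparisons_le_two l .large) hl)
      (by positivity : (0 : ℝ) ≤ L + 1)
    linarith

/-! ### Averages over the outcome counts -/

/-- The sum of `g s m l` over all `s + m + l = k`. -/
def triSum (k : ℕ) (g : ℕ → ℕ → ℕ → ℝ) : ℝ :=
  ∑ x ∈ Finset.HasAntidiagonal.antidiagonal k, ∑ y ∈ Finset.HasAntidiagonal.antidiagonal x.1,
      g y.1 y.2 x.2

theorem triSum_succ (k : ℕ) (g : ℕ → ℕ → ℕ → ℝ) :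
    triSum (k + 1) g = triSum k (fun s m l => g s m (l + 1)) +
      ∑ y ∈ Finset.HasAntidiagonal.antidiagonal (k + 1), g y.1 y.2 0 := by
  simp only [triSum]
  rw [Finset.Nat.sum_antidiagonal_succ', add_comm]

theorem triSum_add (k : ℕ) (f g : ℕ → ℕ → ℕ → ℝ) :
    triSum k (fun s m l => f s m l + g s m l) = triSum k f + triSum k g := by
  simp only [triSum, Finset.sum_add_distrib]

theorem triSum_mul_left (k : ℕ) (r : ℝ) (f : ℕ → ℕ → ℕ → ℝ) :
    triSum k (fun s m l => r * f s m l) = r * triSum k f := by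
  simp only [triSum, Finset.mul_sum]

theorem triSum_congr {k : ℕ} {f g : ℕ → ℕ → ℕ → ℝ}
    (h : ∀ s m l, s + m + l = k → f s m l = g s m l) : triSum k f = triSum k g := by
  refine Finset.sum_congr rfl fun x hx => Finset.sum_congr rfl fun y hy => h _ _ _ ?_
  rw [Finset.HasAntidiagonal.mem_antidiagonal] at hx hy
  omega

theorem triSum_mono {k : ℕ} {f g : ℕ → ℕ → ℕ → ℝ}
    (h : ∀ s m l, s + m + l = k → f s m l ≤ g s m l) : triSum k f ≤ triSum k g := by
  refine Finset.sum_le_sum fun x hx => Finset.sum_le_sum fun y hy => h _ _ _ ?_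
  rw [Finset.HasAntidiagonal.mem_antidiagonal] at hx hy
  omega

theorem triSum_swap_fst (k : ℕ) (g : ℕ → ℕ → ℕ → ℝ) :
    triSum k (fun s m l => g m s l) = triSum k g :=
  Finset.sum_congr rfl fun x _ => Finset.Nat.sum_antidiagonal_swap (f := fun y => g y.1 y.2 x.2)

theorem triSum_swap_snd (k : ℕ) (g : ℕ → ℕ → ℕ → ℝ) :
    triSum k (fun s m l => g s l m) = triSum k g := by
  simp only [triSum, Finset.sum_sigma']
  refine Finset.sum_nbij' (fun x => ⟨(x.2.1 + x.1.2, x.2.2), (x.2.1, x.1.2)⟩)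
    (fun x => ⟨(x.2.1 + x.1.2, x.2.2), (x.2.1, x.1.2)⟩) ?_ ?_ ?_ ?_ ?_
  all_goals
    rintro ⟨⟨a, b⟩, c, d⟩ h
    simp only [Finset.mem_sigma, Finset.HasAntidiagonal.mem_antidiagonal] at h
    obtain ⟨h1, rfl⟩ := h
  · simp; omega
  · simp; omega
  · rfl
  · rfl
  · rfl

theorem triSum_one (k : ℕ) : triSum k (fun _ _ _ => 1) = (k + 1) * (k + 2) / 2 := by
  induction k with
  | zero => simp [triSum]
  | succ k ih =>
    rw [triSum_succ, ih]
    simp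
    ring

theorem triSum_mul_large (k : ℕ) (g : ℕ → ℕ → ℕ → ℝ) :
    triSum (k + 1) (fun s m l => l * g s m l) =
      triSum k (fun s m l => (l + 1) * g s m (l + 1)) := by
  rw [triSum_succ]
  simp

theorem triSum_mul_medium (k : ℕ) (g : ℕ → ℕ → ℕ → ℝ) :
    triSum (k + 1) (fun s m l => m * g s m l) =
      triSum k (fun s m l => (m + 1) * g s (m + 1) l) := by
  rw [← triSum_swap_snd, triSum_mul_large k (fun s l m => g s m l), ← triSum_swap_snd]

theorem triSum_mul_small (k : ℕ) (g : ℕ → ℕ → ℕ → ℝ) :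
    triSum (k + 1) (fun s m l => s * g s m l) =
      triSum k (fun s m l => (s + 1) * g (s + 1) m l) := by
  rw [← triSum_swap_fst, triSum_mul_medium k (fun s l m => g l s m), ← triSum_swap_fst]

/-- The average of `g s m l` over all `s + m + l = k`. -/
noncomputable def triMean (k : ℕ) (g : ℕ → ℕ → ℕ → ℝ) : ℝ :=
  triSum k g / ((k + 1) * (k + 2) / 2)

theorem triMean_add (k : ℕ) (f g : ℕ → ℕ → ℕ → ℝ) :
    triMean k (fun s m l => f s m l + g s m l) = triMean k f + triMean k g := by
  rw [triMean, triSum_add, add_div]; rfl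

theorem triMean_const (k : ℕ) (r : ℝ) : triMean k (fun _ _ _ => r) = r := by
  have := triSum_mul_left k r fun _ _ _ => 1
  simp only [mul_one] at this
  rw [triMean, this, triSum_one]
  field_simp

/-- The outcome counts of the Pólya urn are uniformly distributed after each number of steps. -/
theorem triMean_step (k : ℕ) (g : ℕ → ℕ → ℕ → ℝ) :
    triMean k (step g) = triMean (k + 1) g := by
  have h1 : triSum k (step g) * (k + 3) = (k + 1) * triSum (k + 1) g := by
    calc triSum k (step g) * (k + 3)
        = triSum k (fun s m l => ((s + 1) * g (s + 1) m l + (m + 1) * g s (m + 1) l) +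
            (l + 1) * g s m (l + 1)) := by
          rw [mul_comm, ← triSum_mul_left]
          refine triSum_congr fun s m l h => ?_
          rw [step, ← h]
          push_cast
          field_simp
      _ = triSum (k + 1) (fun s m l => (s * g s m l + m * g s m l) + l * g s m l) := by
          rw [triSum_add, triSum_add, triSum_add, triSum_add, triSum_mul_small, triSum_mul_medium,
            triSum_mul_large]
      _ = (k + 1) * triSum (k + 1) g := by
          rw [← triSum_mul_left]
          refine triSum_congr fun s m l h => ?_
          have : (s + m + l : ℝ) = k + 1 := by exact_mod_cast h
          rw [← this]; ring
  rw [triMean, triMean, div_eq_div_iff (by positivity) (by positivity)]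
  push_cast
  linear_combination (k + 2 : ℝ) / 2 * h1

theorem triMean_zero (g : ℕ → ℕ → ℕ → ℝ) : triMean 0 g = g 0 0 0 := by
  simp [triMean, triSum]

/-- The terms with both coordinates positive are those for `j`, each increased by one; the other two
terms are equal to one. -/
theorem sum_antidiagonal_min (j : ℕ) :
    ∑ y ∈ Finset.HasAntidiagonal.antidiagonal (j + 2), ((min y.1 y.2 + 1 : ℕ) : ℝ) =
      ∑ y ∈ Finset.HasAntidiagonal.antidiagonal j, ((min y.1 y.2 + 1 : ℕ) : ℝ) + (j + 3) := by
  rw [Finset.Nat.sum_antidiagonal_succ, Finset.Nat.sum_antidiagonal_succ']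
  simp only [← Nat.succ_eq_add_one, ← Nat.succ_min_succ]
  simp [Finset.sum_add_distrib]
  ring

theorem sum_antidiagonal_min_bounds (j : ℕ) :
    (j + 1) * (j + 3) / 4 ≤
        ∑ y ∈ Finset.HasAntidiagonal.antidiagonal j, ((min y.1 y.2 + 1 : ℕ) : ℝ) ∧
      ∑ y ∈ Finset.HasAntidiagonal.antidiagonal j, ((min y.1 y.2 + 1 : ℕ) : ℝ) ≤
        ((j : ℝ) + 2) ^ 2 / 4 := by
  induction j using Nat.twoStepInduction with
  | zero => norm_num
  | one => norm_num [Finset.Nat.antidiagonal_succ]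
  | more j h _ =>
    rw [sum_antidiagonal_min]
    generalize ∑ y ∈ Finset.HasAntidiagonal.antidiagonal j, ((min y.1 y.2 + 1 : ℕ) : ℝ) = t at *
    push_cast
    constructor <;> linarith [h.1, h.2]

theorem triSum_min_bounds (k : ℕ) :
    ((k : ℝ) + 1) * (k + 2) * (k + 3) / 12 ≤ triSum k (fun s _ l => (min s l + 1 : ℕ)) ∧
      triSum k (fun s _ l => (min s l + 1 : ℕ)) ≤ ((k : ℝ) + 2) * (k + 3) * (k + 4) / 12 := by
  rw [← triSum_swap_snd]
  induction k with
  | zero => norm_num [triSum]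
  | succ k ih =>
    have h := sum_antidiagonal_min_bounds (k + 1)
    rw [triSum_succ]
    generalize triSum k (fun s l _ => ((min s l + 1 : ℕ) : ℝ)) = t at *
    generalize ∑ y ∈ Finset.HasAntidiagonal.antidiagonal (k + 1),
      ((min y.1 y.2 + 1 : ℕ) : ℝ) = u at *
    push_cast at *
    have hk : (0 : ℝ) ≤ k := Nat.cast_nonneg k
    constructor <;> linarith [h.1, h.2, ih.1, ih.2]

theorem triSum_medium (k : ℕ) :
    triSum k (fun _ m _ => (m + 1 : ℝ)) = (k + 1) * (k + 2) * (k + 3) / 6 := by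
  rw [← triSum_swap_snd]
  induction k with
  | zero => norm_num [triSum]
  | succ k ih =>
    have h : triSum k (fun _ _ m => ((m + 1 : ℕ) + 1 : ℝ)) =
        triSum k (fun _ _ m => (m + 1 : ℝ)) + triSum k (fun _ _ _ => 1) := by
      rw [← triSum_add]; push_cast; rfl
    rw [triSum_succ, h, ih, triSum_one]
    simp
    ring

theorem triMean_best (k : ℕ) : triMean k best =
    4 / 3 + triSum k (fun s _ l => (min s l + 1 : ℕ)) * (2 / ((k + 1) * (k + 2) * (k + 3))) := by
  have h : triSum k best = triSum k (fun _ _ _ => 1) + (k + 3 : ℝ)⁻¹ *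
      (triSum k (fun _ m _ => (m + 1 : ℝ)) + triSum k (fun s _ l => (min s l + 1 : ℕ))) := by
    rw [← triSum_add, ← triSum_mul_left, ← triSum_add]
    refine triSum_congr fun s m l h => ?_
    rw [best, ← h]
    push_cast
    ring
  rw [triMean, h, triSum_one, triSum_medium]
  field_simp
  ring

/-- In the limit the medium elements contribute `1 / 3` and the minimum of the numbers of small and
large elements contributes `1 / 6`. -/
theorem le_triMean_best (k : ℕ) : 3 / 2 ≤ triMean k best := by
  rw [triMean_best]
  have h := mul_le_mul_of_nonneg_right (triSum_min_bounds k).1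
    (by positivity : (0 : ℝ) ≤ 2 / ((k + 1) * (k + 2) * (k + 3)))
  refine le_trans (le_of_eq ?_) (add_le_add_right h _)
  field_simp
  norm_num

theorem triMean_best_le (k : ℕ) : triMean k best ≤ 3 / 2 + 1 / (k + 1) := by
  rw [triMean_best]
  have h := mul_le_mul_of_nonneg_right (triSum_min_bounds k).2
    (by positivity : (0 : ℝ) ≤ 2 / ((k + 1) * (k + 2) * (k + 3)))
  refine (add_le_add_right h _).trans ?_
  rw [← sub_nonneg]
  have : (3 : ℝ) / 2 + 1 / (k + 1) - (4 / 3 + (k + 2) * (k + 3) * (k + 4) / 12 *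
      (2 / ((k + 1) * (k + 2) * (k + 3)))) = 1 / (2 * (k + 1)) := by
    field_simp
    ring
  rw [this]
  positivity

theorem le_triMean_bestSum (j k : ℕ) : 3 / 2 * k ≤ triMean j (bestSum k) := by
  induction k generalizing j with
  | zero => simp [bestSum, triMean_const]
  | succ k ih =>
    have h : triMean j (bestSum (k + 1)) = triMean j best + triMean (j + 1) (bestSum k) := by
      rw [← triMean_step, ← triMean_add]; rfl
    rw [h]
    push_cast
    linarith [le_triMean_best j, ih (j + 1)]

theorem triMean_sampleBound_le (i j k : ℕ) :
    triMean i (sampleBound j k) ≤ 2 * j + k * (3 / 2 + 1 / ((i + j : ℕ) + 1)) := by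
  induction j generalizing i k with
  | zero =>
    have h : triMean i (sampleBound 0 k) = k * triMean i best := by
      rw [triMean, triMean, ← mul_div_assoc, ← triSum_mul_left]; rfl
    rw [h]
    simpa using mul_le_mul_of_nonneg_left (triMean_best_le i) (Nat.cast_nonneg k)
  | succ j ih =>
    cases k with
    | zero =>
      have h : triMean i (sampleBound (j + 1) 0) = 0 := triMean_const i 0
      rw [h]; positivity
    | succ k =>
      have h : triMean i (sampleBound (j + 1) (k + 1)) =
          2 + triMean (i + 1) (sampleBound j k) := by
        have e := triMean_add i (fun _ _ _ => 2) (step (sampleBound j k))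
        rwa [triMean_const, triMean_step] at e
      have h1 := ih (i + 1) k
      rw [show i + 1 + j = i + (j + 1) by ring] at h1
      have h2 : (0 : ℝ) ≤ 1 / ((i + (j + 1) : ℕ) + 1) := by positivity
      rw [h]
      push_cast at *
      linarith

theorem le_mean {k : ℕ} (T : DTree k) : 3 / 2 * k ≤ T.mean [] :=
  (le_triMean_bestSum 0 k).trans (triMean_zero _ ▸ bestSum_le_mean T [])

theorem mean_le {sz k : ℕ} (T : DTree k) (hT : T.SamplesAfter sz []) :
    T.mean [] ≤ 2 * sz + k * (3 / 2 + 1 / (sz + 1)) := by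
  refine (mean_le_sampleBound T [] hT (Nat.zero_le _)).trans ?_
  simpa [triMean_zero] using triMean_sampleBound_le 0 sz k

/-! ### Orderings of a finite set -/

/-- The finite set of all orderings of the elements of `S`. -/
noncomputable def orders (S : Finset ℕ) : Finset (List ℕ) := S.toList.permutations.toFinset

theorem mem_orders {S : Finset ℕ} {l : List ℕ} : l ∈ orders S ↔ (l : Multiset ℕ) = S.val := by
  rw [orders, List.mem_toFinset, List.mem_permutations, ← Multiset.coe_eq_coe, Finset.coe_toList]

theorem card_orders (S : Finset ℕ) : (orders S).card = S.card ! := by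
  rw [orders, List.toFinset_card_of_nodup (List.nodup_permutations _ S.nodup_toList),
    List.length_permutations, Finset.length_toList]

theorem length_of_mem_orders {S : Finset ℕ} {l : List ℕ} (h : l ∈ orders S) :
    l.length = S.card := by
  rw [← Multiset.coe_card, mem_orders.1 h]; rfl

theorem mem_of_mem_orders {S : Finset ℕ} {l : List ℕ} (h : l ∈ orders S) {x : ℕ} :
    x ∈ l ↔ x ∈ S := by
  rw [← Multiset.mem_coe, mem_orders.1 h]; rfl

/-- An injection into the orderings of `S` from a set of the same size is a reindexing. -/
theorem sum_orders_of_injOn {β : Type*} {S : Finset ℕ} (s : Finset β) (e : β → List ℕ)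
    (he : ∀ x ∈ s, e x ∈ orders S) (hinj : Set.InjOn e s) (hs : s.card = S.card !)
    (Q : List ℕ → ℝ) : ∑ x ∈ s, Q (e x) = ∑ l ∈ orders S, Q l :=
  Finset.sum_nbij e he hinj
    (Finset.surjOn_of_injOn_of_card_le e he hinj (by rw [hs, card_orders])) fun _ _ => rfl

theorem sum_orders_cons {S : Finset ℕ} (hS : S.Nonempty) (Q : List ℕ → ℝ) :
    ∑ l ∈ orders S, Q l = ∑ x ∈ S, ∑ l ∈ orders (S.erase x), Q (x :: l) := by
  rw [Finset.sum_sigma']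
  symm
  refine sum_orders_of_injOn (S.sigma fun x => orders (S.erase x)) (fun y => y.1 :: y.2) ?_ ?_ ?_ Q
  · rintro ⟨x, l⟩ h
    rw [Finset.mem_sigma] at h
    rw [mem_orders, ← Multiset.cons_coe, mem_orders.1 h.2, Finset.erase_val,
      Multiset.cons_erase h.1]
  · rintro ⟨x, l⟩ _ ⟨x', l'⟩ _ h
    simp only [List.cons.injEq] at h
    obtain ⟨rfl, rfl⟩ := h
    rfl
  · rw [Finset.card_sigma, Finset.sum_congr rfl fun x hx => by
      rw [card_orders, Finset.card_erase_of_mem hx]]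
    rw [Finset.sum_const, smul_eq_mul, Nat.mul_factorial_pred (Finset.card_pos.2 hS).ne']

theorem sum_orders_reverse (S : Finset ℕ) (Q : List ℕ → ℝ) :
    ∑ l ∈ orders S, Q l.reverse = ∑ l ∈ orders S, Q l :=
  sum_orders_of_injOn _ _ (fun l hl => by
    rw [mem_orders, Multiset.coe_reverse]; exact mem_orders.1 hl)
    List.reverse_injective.injOn (card_orders S) Q

theorem sum_orders_concat {S : Finset ℕ} (hS : S.Nonempty) (Q : List ℕ → ℝ) :
    ∑ l ∈ orders S, Q l = ∑ x ∈ S, ∑ l ∈ orders (S.erase x), Q (l ++ [x]) := by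
  rw [← sum_orders_reverse, sum_orders_cons hS]
  refine Finset.sum_congr rfl fun x _ => ?_
  rw [← sum_orders_reverse]
  simp

/-! ### The effect of a partitioning step -/

/-- The class of `x` with respect to the pivots `p < q`; it is meant for `x` distinct from
both. -/
def cls (p q x : ℕ) : Cls := (classify .p p q x).1

theorem classify_eq {p q x : ℕ} (hpq : p < q) (hp : x ≠ p) (hq : x ≠ q) (l : Pivot) :
    classify l p q x = (cls p q x, comparisons l (cls p q x)) := by
  cases l <;> simp only [cls, classify] <;> split_ifs <;> first | rfl | omega

/-- The elements of the array `a` in the order in which the tree classifies them. -/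
def DTree.order (p q : ℕ) {k : ℕ} (T : DTree k) (a : Fin k → ℕ) : List ℕ :=
  (T.run p q a).1.map Prod.snd

theorem coe_order (p q : ℕ) {k : ℕ} (T : DTree k) (a : Fin k → ℕ) :
    (T.order p q a : Multiset ℕ) = Finset.univ.val.map a := by
  induction T with
  | leaf => simp [DTree.order, DTree.run]
  | @node k i l next ih =>
    rw [Fin.univ_succAbove _ i]
    simp only [DTree.order, DTree.run, List.map_cons, ← Multiset.cons_coe] at ih ⊢
    rw [ih]
    simp only [Finset.cons_val, Finset.map_val, Multiset.map_cons,
      Multiset.map_map, Fin.coe_succAboveEmb]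
    rfl

/-- Since the tree is deterministic, the array can be reconstructed from the order in which
its elements are inspected. -/
theorem order_injective (p q : ℕ) {k : ℕ} (T : DTree k) :
    Function.Injective (T.order p q) := by
  induction T with
  | leaf => exact fun a a' _ => Subsingleton.elim a a'
  | @node k i l next ih =>
    intro a a' h
    simp only [DTree.order, DTree.run, List.map_cons, List.cons.injEq] at h
    obtain ⟨h1, h2⟩ := h
    rw [h1] at h2
    have h3 := ih _ h2
    rw [← Fin.insertNth_self_removeNth i a, ← Fin.insertNth_self_removeNth i a', h1, h3]

/-- The trace and the cost of a run are functions of the order of inspection. -/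
theorem run_eq {p q : ℕ} (hpq : p < q) {k : ℕ} (T : DTree k) (a : Fin k → ℕ)
    (ha : ∀ j, a j ≠ p ∧ a j ≠ q) :
    T.run p q a = ((T.order p q a).map fun x => (cls p q x, x),
      T.cost ((T.order p q a).map (cls p q))) := by
  induction T with
  | leaf => rfl
  | @node k i l next ih =>
    simp only [DTree.order, DTree.run, List.map_cons, DTree.cost,
      classify_eq hpq (ha i).1 (ha i).2]
    have h := ih (cls p q (a i)) (i.removeNth a) fun j => ha _
    rw [DTree.order] at h
    refine Prod.ext ?_ ?_
    · exact congrArg (_ :: ·) (congrArg Prod.fst h)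
    · exact congrArg (_ + ·) (congrArg Prod.snd h)

/-- A decision tree only permutes the possible orderings, so a sum over all arrays can be taken over
all orders of inspection instead. -/
theorem sum_orders_order (p q : ℕ) {k : ℕ} (T : DTree k) {R : Finset ℕ} (hR : R.card = k)
    (Q : List ℕ → ℝ) :
    ∑ a ∈ orders R, Q (T.order p q fun j => a.getD j 0) = ∑ b ∈ orders R, Q b := by
  have key {a : List ℕ} (ha : a ∈ orders R) : List.ofFn (fun j : Fin k => a.getD j 0) = a := by
    have hl := length_of_mem_orders ha
    refine List.ext_getElem (by simp [hl, hR]) fun i h1 h2 => ?_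
    rw [List.getElem_ofFn]
    exact List.getD_eq_getElem _ _ h2
  refine sum_orders_of_injOn (orders R) (fun a => T.order p q fun j => a.getD j 0) ?_ ?_
    (card_orders R) Q
  · intro a ha
    rw [mem_orders, coe_order, Fin.univ_val_map, key ha, mem_orders.1 ha]
  · intro a ha a' ha' h
    rw [← key ha, ← key ha', order_injective p q T h]

open Finset in
/-- A word is produced by as many orderings of `R` as there are ways to fill each class, provided
its letter counts are the class sizes. -/
theorem sum_orders_word (κ : ℕ → Cls) (k : ℕ) (R : Finset ℕ) (hR : #R = k) (f : List Cls → ℝ) :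
    ∑ b ∈ orders R, f (b.map κ) =
      wordSum k fun w => if ∀ c, w.count c = #{x ∈ R | κ x = c} then weight w * f w else 0 := by
  induction k generalizing R f with
  | zero =>
    obtain rfl := Finset.card_eq_zero.1 hR
    simp [orders, wordSum, weight]
  | succ k ih =>
    rw [sum_orders_cons (Finset.card_pos.1 (by omega)),
      ← Finset.sum_fiberwise (s := R) (g := κ)]
    simp only [wordSum, List.map_cons]
    refine Finset.sum_congr rfl fun c _ => ?_
    -- A first element of class `c` leaves the same sum whichever element it is, and their number
    -- supplies the missing factor of `weight (c :: w)`.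
    have h (x : ℕ) (hx : x ∈ R.filter (κ · = c)) :
        ∑ l ∈ orders (R.erase x), f (κ x :: l.map κ) = wordSum k fun w =>
          if ∀ d, (c :: w).count d = #{x ∈ R | κ x = d} then weight w * f (c :: w) else 0 := by
      obtain ⟨hxR, rfl⟩ := Finset.mem_filter.1 hx
      rw [ih (R.erase x) (by rw [Finset.card_erase_of_mem hxR, hR]; rfl)
        (fun w => f (κ x :: w))]
      refine wordSum_congr fun w _ => ?_
      refine if_congr (forall_congr' fun d => ?_) rfl rfl
      rw [Finset.filter_erase, List.count_cons]
      by_cases hd : κ x = d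
      · have hm : x ∈ R.filter (κ · = d) := Finset.mem_filter.2 ⟨hxR, hd⟩
        have := Finset.card_pos.2 ⟨x, hm⟩
        rw [Finset.card_erase_of_mem hm]
        simp [hd]
        omega
      · rw [Finset.erase_eq_of_notMem (by simp [hd])]
        simp [hd]
    rw [Finset.sum_congr rfl h, Finset.sum_const, nsmul_eq_mul, ← wordSum_mul_left]
    refine wordSum_congr fun w _ => ?_
    split_ifs with hw
    · rw [← hw c, ← mul_assoc]
      congr 1
      have : weight (c :: w) = weight (w ++ [c]) := by
        unfold weight
        refine Finset.prod_congr rfl fun d _ => ?_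
        rw [List.count_append, List.count_cons, List.count_singleton]
      rw [this, weight_concat, mul_comm]
      simp
    · simp

/-- The subarray of class `c` after the elements have been inspected in the order `b`. -/
def subarray (ρ : Arrangement) (κ : ℕ → Cls) (b : List ℕ) (c : Cls) : List ℕ :=
  group ρ (b.map fun x => (κ x, x)) c

theorem subarray_eq (ρ : Arrangement) (κ : ℕ → Cls) (b : List ℕ) (c : Cls) :
    subarray ρ κ b c = List.ofFn fun j => (b.filter (κ · = c)).get
      (ρ (b.map κ) c (b.filter (κ · = c)).length j) := by
  have h1 : ((b.map fun x => (κ x, x)).filter fun e => e.1 = c).map Prod.snd =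
      b.filter (κ · = c) := by
    rw [List.filter_map, List.map_map]
    simp [Function.comp_def]
  have h2 : (b.map fun x => (κ x, x)).map Prod.fst = b.map κ := by simp [Function.comp_def]
  simp only [subarray, group]
  rw [h1, h2]

theorem subarray_mem_orders (ρ : Arrangement) (κ : ℕ → Cls) {R : Finset ℕ} {b : List ℕ}
    (hb : b ∈ orders R) (c : Cls) : subarray ρ κ b c ∈ orders (R.filter (κ · = c)) := by
  rw [mem_orders, subarray_eq, Finset.filter_val, ← mem_orders.1 hb, Multiset.filter_coe,
    Multiset.coe_eq_coe]
  have := Equiv.Perm.ofFn_comp_perm (ρ (b.map κ) c (b.filter (κ · = c)).length)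
    (b.filter (κ · = c)).get
  rw [List.ofFn_get] at this
  exact this

theorem subarray_map (ρ : Arrangement) (κ : ℕ → Cls) (σ : Equiv.Perm ℕ)
    (hσ : ∀ x, κ (σ x) = κ x) (b : List ℕ) (c : Cls) :
    subarray ρ κ (b.map σ) c = (subarray ρ κ b c).map σ := by
  have h1 : (b.map σ).filter (κ · = c) = (b.filter (κ · = c)).map σ := by
    rw [List.filter_map]; simp [Function.comp_def, hσ]
  have h2 : (b.map σ).map κ = b.map κ := by simp [Function.comp_def, hσ]
  -- The lengths of the two lists are only propositionally equal.
  have h3 (w : List Cls) (m m' : ℕ) (h : m = m') (i : ℕ) (hi : i < m) (hi' : i < m') :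
      (ρ w c m ⟨i, hi⟩ : ℕ) = ρ w c m' ⟨i, hi'⟩ := by subst h; rfl
  rw [subarray_eq, subarray_eq, h1, h2]
  refine List.ext_getElem (by simp) fun i hi hi' => ?_
  simp only [List.getElem_ofFn, List.getElem_map, List.get_eq_getElem]
  congr 2
  exact h3 _ _ _ (by simp) _ _ _

open Finset in
/-- Partitioning preserves randomness: over all orderings of `R`, each ordering of a class is
produced equally often. Permuting the elements of the class among themselves changes
neither the outcomes nor the arrangement. -/
theorem sum_orders_subarray (ρ : Arrangement) (κ : ℕ → Cls) (R : Finset ℕ) (c : Cls)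
    (Q : List ℕ → ℝ) :
    (#{x ∈ R | κ x = c})! * ∑ b ∈ orders R, Q (subarray ρ κ b c) =
      (#R)! * ∑ l ∈ orders {x ∈ R | κ x = c}, Q l := by
  set A := {x ∈ R | κ x = c} with hA
  have hmem (σ : Equiv.Perm {x // x ∈ A}) (x : ℕ) (hx : x ∈ A) :
      Equiv.Perm.ofSubtype σ x ∈ A := by
    rw [Equiv.Perm.ofSubtype_apply_of_mem σ hx]; exact (σ ⟨x, hx⟩).2
  have hκ (σ : Equiv.Perm {x // x ∈ A}) (x : ℕ) : κ (Equiv.Perm.ofSubtype σ x) = κ x := by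
    by_cases hx : x ∈ A
    · rw [(Finset.mem_filter.1 (hmem σ x hx)).2, (Finset.mem_filter.1 hx).2]
    · rw [Equiv.Perm.ofSubtype_apply_of_not_mem σ hx]
  have hRmem (σ : Equiv.Perm {x // x ∈ A}) (x : ℕ) (hx : x ∈ R) :
      Equiv.Perm.ofSubtype σ x ∈ R := by
    by_cases hx' : x ∈ A
    · exact (Finset.mem_filter.1 (hmem σ x hx')).1
    · rwa [Equiv.Perm.ofSubtype_apply_of_not_mem σ hx']
  have hord {S : Finset ℕ} (σ : Equiv.Perm ℕ) (hS : ∀ x ∈ S, σ x ∈ S) (b : List ℕ)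
      (hb : b ∈ orders S) : b.map σ ∈ orders S := by
    rw [mem_orders, ← Multiset.map_coe, mem_orders.1 hb]
    have : S.map σ.toEmbedding = S := by
      refine Finset.eq_of_subset_of_card_le (fun y hy => ?_) (by simp)
      obtain ⟨x, hx, rfl⟩ := Finset.mem_map.1 hy
      exact hS x hx
    exact congrArg Finset.val this
  have h1 (σ : Equiv.Perm {x // x ∈ A}) :
      ∑ b ∈ orders R, Q ((subarray ρ κ b c).map (Equiv.Perm.ofSubtype σ)) =
        ∑ b ∈ orders R, Q (subarray ρ κ b c) := by
    simp only [← subarray_map ρ κ _ (hκ σ)]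
    exact sum_orders_of_injOn (orders R) (fun b => b.map (Equiv.Perm.ofSubtype σ))
      (hord _ (hRmem σ)) (List.map_injective_iff.2 (Equiv.injective _)).injOn (card_orders R)
      fun b => Q (subarray ρ κ b c)
  have h2 (L : List ℕ) (hL : L ∈ orders A) :
      ∑ σ : Equiv.Perm {x // x ∈ A}, Q (L.map (Equiv.Perm.ofSubtype σ)) =
        ∑ l ∈ orders A, Q l := by
    refine sum_orders_of_injOn Finset.univ
      (fun σ : Equiv.Perm {x // x ∈ A} => L.map (Equiv.Perm.ofSubtype σ))
      (fun σ _ => hord _ (hmem σ) L hL) (fun σ _ τ _ h => ?_) ?_ Q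
    · ext ⟨x, hx⟩
      have := List.map_inj_left.1 h x ((mem_of_mem_orders hL).2 hx)
      rwa [Equiv.Perm.ofSubtype_apply_of_mem σ hx, Equiv.Perm.ofSubtype_apply_of_mem τ hx] at this
    · rw [Finset.card_univ, Fintype.card_perm, Fintype.card_coe]
  calc ((#A)! : ℝ) * ∑ b ∈ orders R, Q (subarray ρ κ b c)
      = ∑ σ : Equiv.Perm {x // x ∈ A}, ∑ b ∈ orders R,
          Q ((subarray ρ κ b c).map (Equiv.Perm.ofSubtype σ)) := by
        simp only [h1, Finset.sum_const, Finset.card_univ, Fintype.card_perm, Fintype.card_coe,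
          nsmul_eq_mul]
    _ = ∑ b ∈ orders R, ∑ l ∈ orders A, Q l := by
        rw [Finset.sum_comm]
        exact Finset.sum_congr rfl fun b hb => h2 _ (subarray_mem_orders ρ κ hb c)
    _ = _ := by rw [Finset.sum_const, card_orders, nsmul_eq_mul]

/-- One unfolding of quicksort on an array with outer elements `x` and `y`, in terms of the order in
which the tree inspects the inner elements `a`. -/
theorem quicksort_snd (T : (n : ℕ) → DTree (n - 2)) (ρ : Arrangement) {k : ℕ} {x y : ℕ}
    (hxy : x ≠ y) {a : List ℕ} (hk : a.length = k) (ha : ∀ z ∈ a, z ≠ x ∧ z ≠ y) :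
    (quicksort T ρ (x :: (a ++ [y]))).2 =
      1 + (T (k + 2)).cost (((T (k + 2)).order (min x y) (max x y) fun j : Fin k =>
          a.getD j 0).map (cls (min x y) (max x y))) +
        ∑ c, (quicksort T ρ (subarray ρ (cls (min x y) (max x y))
          ((T (k + 2)).order (min x y) (max x y) fun j : Fin k => a.getD j 0) c)).2 := by
  have hlen : (x :: (a ++ [y])).length = k + 2 := by simp [hk]
  have hrun (N : ℕ) (hN : N = k + 2) (f : Fin (N - 2) → ℕ) (hf : ∀ j, f j = a.getD j 0) :
      (T N).run (min x y) (max x y) f =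
        (T (k + 2)).run (min x y) (max x y) fun j : Fin k => a.getD j 0 := by
    subst hN
    rw [funext hf]; rfl
  have hlast : (x :: (a ++ [y]))[(x :: (a ++ [y])).length - 1]'(by simp) = y := by simp
  have hlt (N : ℕ) (j : Fin (N - 2)) : (j : ℕ) + 1 < N ∧ (j : ℕ) < N - 2 :=
    ⟨by have := j.2; omega, j.2⟩
  have hf (j : Fin ((x :: (a ++ [y])).length - 2)) :
      (x :: (a ++ [y]))[(j : ℕ) + 1]'(hlt _ j).1 = a.getD j 0 := by
    have hj : (j : ℕ) < a.length := (hlt _ j).2.trans_eq (by rw [hlen, hk]; rfl)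
    simp [List.getElem_append_left hj, hj]
  rw [quicksort, dif_neg (by omega)]
  simp only [hlast, List.getElem_cons_zero]
  rw [hrun _ hlen _ hf, run_eq (by omega) (T (k + 2))]
  · rw [sum_cls]
    simp only [subarray]
    omega
  · intro j
    have hj : (j : ℕ) < a.length := by have := j.2; omega
    have := ha (a.getD j 0) (by simp [hj])
    omega

/-! ### Ranks of the pivots -/

open Finset in
/-- The number of smaller elements of `S` takes each value exactly once. -/
theorem sum_rank (S : Finset ℕ) (k : ℕ) (hS : #S = k + 1) (g : ℕ → ℕ → ℝ) :
    ∑ x ∈ S, g #{y ∈ S | y < x} #{y ∈ S | x < y} =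
      ∑ z ∈ HasAntidiagonal.antidiagonal k, g z.1 z.2 := by
  induction S using Finset.induction_on_max generalizing k g with
  | empty => simp at hS
  | insert a S ha ih =>
    have haS : a ∉ S := fun h => lt_irrefl _ (ha a h)
    rw [card_insert_of_notMem haS] at hS
    have h1 : {y ∈ insert a S | y < a} = S := by
      rw [filter_insert, if_neg (lt_irrefl a), filter_true_of_mem ha]
    have h2 : {y ∈ insert a S | a < y} = ∅ := by
      rw [filter_insert, if_neg (lt_irrefl a), filter_false_of_mem fun y hy => (ha y hy).not_gt]
    have h3 (x : ℕ) (hx : x ∈ S) : g #{y ∈ insert a S | y < x} #{y ∈ insert a S | x < y} =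
        g #{y ∈ S | y < x} (#{y ∈ S | x < y} + 1) := by
      rw [filter_insert, if_neg (ha x hx).not_gt, filter_insert, if_pos (ha x hx),
        card_insert_of_notMem fun h => haS (mem_filter.1 h).1]
    rw [sum_insert haS, sum_congr rfl h3, h1, h2, card_empty]
    cases k with
    | zero =>
      obtain rfl : S = ∅ := card_eq_zero.1 (by omega)
      simp
    | succ k =>
      rw [ih k (by omega) (fun i j => g i (j + 1)), Nat.sum_antidiagonal_succ']
      congr 2
      omega

open Finset in
/-- The numbers of small, medium and large elements for the pivot pairs `p < q` from `S` take
each triple of sum `#S - 2` exactly once. -/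
theorem sum_pivots (S : Finset ℕ) (k : ℕ) (hS : #S = k + 2) (g : ℕ → ℕ → ℕ → ℝ) :
    ∑ q ∈ S, ∑ p ∈ S with p < q, g #{y ∈ S | y < p} #{y ∈ S | p < y ∧ y < q} #{y ∈ S | q < y} =
      triSum k g := by
  have h (q : ℕ) : ∑ p ∈ S with p < q,
      g #{y ∈ S | y < p} #{y ∈ S | p < y ∧ y < q} #{y ∈ S | q < y} =
      (fun j l => if j = 0 then 0 else
        ∑ z ∈ HasAntidiagonal.antidiagonal (j - 1), g z.1 z.2 l) #{y ∈ S | y < q}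
          #{y ∈ S | q < y} := by
    dsimp only
    split_ifs with h0
    · rw [card_eq_zero.1 h0, sum_empty]
    · rw [← sum_rank {y ∈ S | y < q} _ (by omega) fun i j => g i j #{y ∈ S | q < y}]
      refine sum_congr rfl fun p hp => ?_
      have hpq := (mem_filter.1 hp).2
      rw [filter_filter, filter_filter]
      congr 2 <;> refine filter_congr fun y _ => ?_ <;> omega
  rw [sum_congr rfl fun q _ => h q, sum_rank S (k + 1) hS fun j l => if j = 0 then 0 else
    ∑ z ∈ HasAntidiagonal.antidiagonal (j - 1), g z.1 z.2 l]
  rw [Nat.sum_antidiagonal_succ]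
  simp [triSum]

open Finset in
/-- A sum over ordered pairs of distinct elements that depends only on the unordered pair. -/
theorem sum_sum_erase (S : Finset ℕ) (g : ℕ → ℕ → ℝ) :
    ∑ x ∈ S, ∑ y ∈ S.erase x, g (min x y) (max x y) = 2 * ∑ q ∈ S, ∑ p ∈ S with p < q, g p q := by
  have h1 (x : ℕ) : ∑ y ∈ S.erase x, g (min x y) (max x y) =
      ∑ y ∈ S with y < x, g y x + ∑ y ∈ S with x < y, g x y := by
    rw [← sum_filter_add_sum_filter_not (S.erase x) (· < x)]
    congr 1
    · refine sum_congr (by grind) fun y hy => ?_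
      have := (mem_filter.1 hy).2
      rw [min_eq_right this.le, max_eq_left this.le]
    · refine sum_congr (by grind) fun y hy => ?_
      have := (mem_filter.1 hy).2
      rw [min_eq_left this.le, max_eq_right this.le]
  have h2 : ∑ x ∈ S, ∑ y ∈ S with x < y, g x y = ∑ q ∈ S, ∑ p ∈ S with p < q, g p q := by
    simp only [sum_filter]
    exact sum_comm
  rw [sum_congr rfl fun x _ => h1 x, sum_add_distrib, h2, two_mul]

/-- Among all triples of sum `k`, exactly one consists of the letter counts `w`. -/
theorem triSum_eq (k : ℕ) (w : Cls → ℕ) (hw : w .small + w .medium + w .large = k) (r : ℝ) :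
    triSum k (fun s m l =>
      if w .small = s ∧ w .medium = m ∧ w .large = l then r else 0) = r := by
  rw [triSum, Finset.sum_eq_single (w .small + w .medium, w .large),
    Finset.sum_eq_single (w .small, w .medium)]
  · simp
  · rintro ⟨a, b⟩ _ h
    rw [if_neg]
    rintro ⟨rfl, rfl, _⟩
    exact h rfl
  · simp
  · rintro ⟨a, b⟩ h h'
    refine Finset.sum_eq_zero fun y hy => if_neg ?_
    rintro ⟨h1, h2, rfl⟩
    rw [Finset.HasAntidiagonal.mem_antidiagonal] at hy
    exact h' (by rw [h1, h2, hy])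
  · simp [hw]

theorem triSum_wordSum (k n : ℕ) (f : ℕ → ℕ → ℕ → List Cls → ℝ) :
    triSum n (fun s m l => wordSum k (f s m l)) =
      wordSum k fun w => triSum n fun s m l => f s m l w := by
  simp only [triSum, wordSum_sum]

open Finset in
theorem card_cls {S : Finset ℕ} {p q : ℕ} (hpq : p < q) :
    #{x ∈ (S.erase p).erase q | cls p q x = .small} = #{y ∈ S | y < p} ∧
      #{x ∈ (S.erase p).erase q | cls p q x = .medium} = #{y ∈ S | p < y ∧ y < q} ∧
      #{x ∈ (S.erase p).erase q | cls p q x = .large} = #{y ∈ S | q < y} := by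
  have h (c : Cls) (P : ℕ → Prop) [DecidablePred P]
      (hP : ∀ x, (x ≠ q ∧ x ≠ p) ∧ cls p q x = c ↔ P x) :
      #{x ∈ (S.erase p).erase q | cls p q x = c} = #{x ∈ S | P x} := by
    congr 1
    ext x
    rw [mem_filter, mem_filter, mem_erase, mem_erase, ← hP x]
    tauto
  refine ⟨h _ _ ?_, h _ _ ?_, h _ _ ?_⟩
  all_goals
    intro x
    simp only [cls, classify]
    split_ifs <;> simp <;> omega

/-! ### The recurrence for the average number of comparisons -/

open Finset in
/-- The total cost for fixed pivots `p < q` over all orders of inspection of the set `R` of the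
other elements. -/
theorem sum_orders_pivots (T : (n : ℕ) → DTree (n - 2)) (ρ : Arrangement) (u : ℕ → ℝ) {k : ℕ}
    {R : Finset ℕ} (hR : #R = k) (p q : ℕ)
    (ih : ∀ A : Finset ℕ, #A ≤ k →
      ∑ l ∈ orders A, ((quicksort T ρ l).2 : ℝ) = (#A)! * u #A) :
    ∑ b ∈ orders R, (1 + ((T (k + 2)).cost (b.map (cls p q)) : ℝ) +
        ∑ c, ((quicksort T ρ (subarray ρ (cls p q) b c)).2 : ℝ)) =
      k ! + wordSum k (fun w => if ∀ c, w.count c = #{x ∈ R | cls p q x = c} then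
          weight w * (T (k + 2)).cost w else 0) +
        ∑ c, k ! * u #{x ∈ R | cls p q x = c} := by
  rw [sum_add_distrib, sum_add_distrib, sum_const, card_orders, hR,
    sum_orders_word (cls p q) k R hR fun w => ((T (k + 2)).cost w : ℝ), sum_comm]
  simp only [nsmul_eq_mul, mul_one]
  congr 1
  refine sum_congr rfl fun c _ => ?_
  have h := sum_orders_subarray ρ (cls p q) R c fun l => ((quicksort T ρ l).2 : ℝ)
  rw [ih _ ((card_filter_le _ _).trans hR.le), hR] at h
  have h0 : ((#{x ∈ R | cls p q x = c})! : ℝ) ≠ 0 := by positivity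
  exact mul_left_cancel₀ h0 (by rw [h]; ring)

open Finset in
/-- The total number of comparisons over all orderings of `S` depends only on the size of `S`, and
is given by the recurrence of dual pivot quicksort. -/
theorem sum_orders_quicksort (T : (n : ℕ) → DTree (n - 2)) (ρ : Arrangement) (u : ℕ → ℝ) {k : ℕ}
    {S : Finset ℕ} (hS : #S = k + 2)
    (ih : ∀ A : Finset ℕ, #A ≤ k →
      ∑ l ∈ orders A, ((quicksort T ρ l).2 : ℝ) = (#A)! * u #A) :
    ∑ l ∈ orders S, ((quicksort T ρ l).2 : ℝ) = (k + 2)! * (1 + (T (k + 2)).mean []) +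
      2 * k ! * triSum k fun s m l => u s + u m + u l := by
  have hcost : wordSum k (fun w => weight w * (T (k + 2)).cost w) =
      (k + 2)! / 2 * (T (k + 2)).mean [] := by
    have h := wordSum_weight_mul_cost (k := k) (T (k + 2)) []
    simpa [weight] using h
  have hpair (p q : ℕ) (hp : p ∈ S) (hq : q ∈ S) (hpq : p ≠ q) :
      #((S.erase p).erase q) = k := by
    rw [card_erase_of_mem (mem_erase.2 ⟨hpq.symm, hq⟩), card_erase_of_mem hp, hS]; rfl
  -- `G p q` is the total cost over all arrays with pivots `p < q` in a fixed order.
  obtain ⟨G, hG⟩ : ∃ G : ℕ → ℕ → ℝ, ∀ p q, G p q = ∑ b ∈ orders ((S.erase p).erase q),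
      (1 + ((T (k + 2)).cost (b.map (cls p q)) : ℝ) +
        ∑ c, ((quicksort T ρ (subarray ρ (cls p q) b c)).2 : ℝ)) := ⟨_, fun _ _ => rfl⟩
  have h1 (x y : ℕ) (hx : x ∈ S) (hy : y ∈ S.erase x) :
      ∑ a ∈ orders ((S.erase x).erase y), ((quicksort T ρ (x :: (a ++ [y]))).2 : ℝ) =
      G (min x y) (max x y) := by
    obtain ⟨hxy, hyS⟩ := mem_erase.1 hy
    have hR := hpair x y hx hyS hxy.symm
    have he : (S.erase (min x y)).erase (max x y) = (S.erase x).erase y := by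
      rcases le_total x y with h | h
      · rw [min_eq_left h, max_eq_right h]
      · rw [min_eq_right h, max_eq_left h, erase_right_comm]
    rw [hG, he, ← sum_orders_order (min x y) (max x y) (k := k) (T (k + 2)) hR fun b =>
      1 + ((T (k + 2)).cost (b.map (cls (min x y) (max x y))) : ℝ) +
        ∑ c, ((quicksort T ρ (subarray ρ (cls (min x y) (max x y)) b c)).2 : ℝ)]
    refine sum_congr rfl fun a ha => ?_
    rw [quicksort_snd T ρ hxy.symm ((length_of_mem_orders ha).trans hR) fun z hz => ?_]
    · push_cast
      rfl
    · have := (mem_of_mem_orders ha).1 hz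
      simp only [mem_erase] at this
      exact ⟨this.2.1, this.1⟩
  -- `H s m l` is the same cost as a function of the class sizes.
  obtain ⟨H, hH⟩ : ∃ H : ℕ → ℕ → ℕ → ℝ, ∀ s m l, H s m l = k ! + wordSum k (fun w =>
      if w.count .small = s ∧ w.count .medium = m ∧ w.count .large = l then
        weight w * (T (k + 2)).cost w else 0) + k ! * (u s + u m + u l) :=
    ⟨_, fun _ _ _ => rfl⟩
  have h2 (q p : ℕ) (hq : q ∈ S) (hp : p ∈ S.filter (· < q)) :
      G p q = H #{y ∈ S | y < p} #{y ∈ S | p < y ∧ y < q} #{y ∈ S | q < y} := by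
    obtain ⟨hpS, hpq⟩ := mem_filter.1 hp
    rw [hG, hH, sum_orders_pivots T ρ u (hpair p q hpS hq hpq.ne) p q ih,
      sum_cls]
    obtain ⟨e1, e2, e3⟩ := card_cls hpq (S := S)
    have h3 (w : List Cls) : (∀ c, w.count c = #{x ∈ (S.erase p).erase q | cls p q x = c}) ↔
        w.count .small = #{y ∈ S | y < p} ∧ w.count .medium = #{y ∈ S | p < y ∧ y < q} ∧
          w.count .large = #{y ∈ S | q < y} := by
      rw [← e1, ← e2, ← e3]
      exact ⟨fun h => ⟨h _, h _, h _⟩, fun h c => by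
        cases c
        exacts [h.1, h.2.1, h.2.2]⟩
    simp only [h3, e1, e2, e3]
    ring
  -- Each word occurs for exactly one choice of the ranks of the two pivots.
  have h4 : triSum k (fun s m l => wordSum k (fun w =>
          if w.count .small = s ∧ w.count .medium = m ∧ w.count .large = l then
            weight w * (T (k + 2)).cost w else 0)) =
      wordSum k (fun w => weight w * (T (k + 2)).cost w) := by
    rw [triSum_wordSum]
    refine wordSum_congr fun w hw => ?_
    exact triSum_eq k (fun c => w.count c) ((count_add_count_add_count w).trans hw) _
  rw [sum_orders_cons (card_pos.1 (by omega)), sum_congr rfl fun x hx => by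
    rw [sum_orders_concat (card_pos.1 (by rw [card_erase_of_mem hx]; omega)),
      sum_congr rfl fun y hy => h1 x y hx hy]]
  rw [sum_sum_erase, sum_congr rfl fun q hq => sum_congr rfl fun p hp => h2 q p hq hp,
    sum_pivots S k hS, triSum_congr fun s m l _ => hH s m l, triSum_add, triSum_add, h4, hcost,
    triSum_mul_left]
  have h5 := triSum_mul_left k (k ! : ℝ) fun _ _ _ => 1
  simp only [mul_one] at h5
  rw [h5, triSum_one, Nat.factorial_succ, Nat.factorial_succ]
  push_cast
  ring

/-- Averaging over permutations is averaging over the orderings of `{1, …, n}`. -/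
theorem sum_orders_Icc (T : (n : ℕ) → DTree (n - 2)) (ρ : Arrangement) (n : ℕ) :
    ∑ l ∈ orders (Finset.Icc 1 n), ((quicksort T ρ l).2 : ℝ) =
      n ! * averageComparisons T ρ n := by
  rw [averageComparisons, mul_div_cancel₀ _ (by positivity)]
  symm
  have hinj (π : Equiv.Perm (Fin n)) : Function.Injective fun i => (π i : ℕ) + 1 := fun i j h =>
    π.injective (Fin.ext (Nat.succ_injective h))
  refine sum_orders_of_injOn Finset.univ
    (fun π : Equiv.Perm (Fin n) => List.ofFn fun i => (π i : ℕ) + 1) (fun π _ => ?_) ?_ ?_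
    fun l => ((quicksort T ρ l).2 : ℝ)
  · rw [mem_orders, ← Fin.univ_val_map]
    have h : Finset.univ.map ⟨_, hinj π⟩ = Finset.Icc 1 n := by
      refine Finset.eq_of_subset_of_card_le (fun y hy => ?_) (by simp)
      obtain ⟨i, -, rfl⟩ := Finset.mem_map.1 hy
      have := (π i).2
      simp
    exact congrArg Finset.val h
  · intro π _ τ _ h
    ext i
    have := congrFun (List.ofFn_injective h) i
    simpa using this
  · simp [Fintype.card_perm]

theorem averageComparisons_of_lt_two (T : (n : ℕ) → DTree (n - 2)) (ρ : Arrangement) {n : ℕ}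
    (hn : n < 2) : averageComparisons T ρ n = 0 := by
  have h (l : List ℕ) (hl : l.length < 2) : (quicksort T ρ l).2 = 0 := by
    rw [quicksort, dif_pos hl]
  rw [averageComparisons, Finset.sum_eq_zero fun π _ => by
    rw [h _ (by simpa using hn), Nat.cast_zero],
    zero_div]

theorem sum_orders_eq (T : (n : ℕ) → DTree (n - 2)) (ρ : Arrangement) (S : Finset ℕ) :
    ∑ l ∈ orders S, ((quicksort T ρ l).2 : ℝ) =
      S.card ! * averageComparisons T ρ S.card := by
  induction hn : S.card using Nat.strong_induction_on generalizing S with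
  | _ n ih =>
    match n, hn, ih with
    | 0, hn, _ | 1, hn, _ =>
      rw [averageComparisons_of_lt_two T ρ (by omega), mul_zero]
      refine Finset.sum_eq_zero fun l hl => ?_
      rw [quicksort, dif_pos (by rw [length_of_mem_orders hl]; omega), Nat.cast_zero]
    | k + 2, hn, ih =>
      have ih' (A : Finset ℕ) (hA : A.card ≤ k) := ih A.card (by omega) A rfl
      rw [← sum_orders_Icc, sum_orders_quicksort T ρ _ hn ih',
        sum_orders_quicksort T ρ _ (by simp) ih']

/-- The recurrence for the average number of comparisons of dual pivot quicksort. -/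
theorem averageComparisons_add_two (T : (n : ℕ) → DTree (n - 2)) (ρ : Arrangement) (k : ℕ) :
    averageComparisons T ρ (k + 2) = 1 + (T (k + 2)).mean [] + 2 / ((k + 1) * (k + 2)) *
      triSum k fun s m l =>
        averageComparisons T ρ s + averageComparisons T ρ m + averageComparisons T ρ l := by
  have h0 : ((k + 2)! : ℝ) ≠ 0 := by positivity
  have h1 := sum_orders_Icc T ρ (k + 2)
  rw [sum_orders_quicksort T ρ _ (k := k) (by simp) fun A _ => sum_orders_eq T ρ A] at h1
  refine mul_left_cancel₀ h0 (h1.symm.trans ?_)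
  have h2 : ((k + 2)! : ℝ) = (k + 2) * ((k + 1) * k !) := by
    rw [Nat.factorial_succ, Nat.factorial_succ]
    push_cast
    ring
  rw [h2]
  field_simp

/-! ### Asymptotic solution of the recurrence -/

/-- The contribution of the recursive calls to the average cost for `k + 2` keys, if `u` gives the
average costs for fewer keys. -/
noncomputable def recursiveCost (u : ℕ → ℝ) (k : ℕ) : ℝ :=
  2 / ((k + 1) * (k + 2)) * triSum k fun s m l => u s + u m + u l

theorem recursiveCost_eq (u : ℕ → ℝ) (k : ℕ) :
    recursiveCost u k = 6 / ((k + 1) * (k + 2)) * triSum k fun s _ _ => u s := by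
  have h1 : triSum k (fun _ m _ => u m) = triSum k fun s _ _ => u s :=
    triSum_swap_fst k fun s _ _ => u s
  have h2 : triSum k (fun _ _ l => u l) = triSum k fun s _ _ => u s := by
    rw [← h1]
    exact triSum_swap_snd k fun _ m _ => u m
  rw [recursiveCost, triSum_add, triSum_add, h1, h2]
  ring

theorem recursiveCost_mono {u v : ℕ → ℝ} {k : ℕ} (h : ∀ n ≤ k, u n ≤ v n) :
    recursiveCost u k ≤ recursiveCost v k := by
  refine mul_le_mul_of_nonneg_left (triSum_mono fun s m l hk => ?_) (by positivity)
  linarith [h s (by omega), h m (by omega), h l (by omega)]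

/-- Comparison principle: the solution of the recurrence is monotone in the initial values and in
the cost of the partitioning steps. -/
theorem le_of_sub_recursiveCost_le {u v : ℕ → ℝ} (h0 : u 0 ≤ v 0) (h1 : u 1 ≤ v 1)
    (h : ∀ k, u (k + 2) - recursiveCost u k ≤ v (k + 2) - recursiveCost v k) (n : ℕ) :
    u n ≤ v n := by
  induction n using Nat.strong_induction_on with
  | _ n ih =>
    match n, ih with
    | 0, _ => exact h0
    | 1, _ => exact h1
    | k + 2, ih =>
      linarith [h k, recursiveCost_mono (k := k) fun n hn => ih n (by omega)]

/-- The combination of `(n + 1) H_n`, a constant and the homogeneous solution `n + 1`. By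
`solution_sub_recursiveCost` it solves the recurrence for partitioning costs that are affine
in `n`. -/
noncomputable def solution (α β γ : ℝ) (n : ℕ) : ℝ :=
  α * ((n + 1) * (harmonic n : ℝ)) + β + γ * (n + 1)

theorem harmonic_succ_real (n : ℕ) : (harmonic (n + 1) : ℝ) = harmonic n + 1 / (n + 1) := by
  rw [harmonic_succ]
  push_cast
  rw [one_div]

theorem sum_antidiagonal_harmonic (k : ℕ) :
    ∑ y ∈ Finset.HasAntidiagonal.antidiagonal k, ((y.1 : ℝ) + 1) * (harmonic y.1 : ℝ) =
      (k + 1) * ((k + 2) * (harmonic (k + 1) : ℝ) / 2 - (3 * k + 12) / 12) := by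
  induction k with
  | zero => norm_num [harmonic_succ]
  | succ k ih =>
    rw [Finset.Nat.sum_antidiagonal_succ']
    simp only
    rw [ih, harmonic_succ_real (k + 1)]
    push_cast
    field_simp
    ring

theorem triSum_harmonic (k : ℕ) :
    triSum k (fun s _ _ => ((s : ℝ) + 1) * (harmonic s : ℝ)) =
      (k + 1) * (k + 2) / 6 * ((k + 3) * (harmonic (k + 2) : ℝ) - (5 * k + 27) / 6) := by
  induction k with
  | zero => norm_num [triSum, harmonic_succ]
  | succ k ih =>
    rw [triSum_succ, ih, sum_antidiagonal_harmonic, harmonic_succ_real (k + 2)]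
    push_cast
    field_simp
    ring

theorem solution_sub_recursiveCost (α β γ : ℝ) (k : ℕ) :
    solution α β γ (k + 2) - recursiveCost (solution α β γ) k =
      α * ((5 * k + 27) / 6) - 2 * β := by
  have h1 : triSum k (fun s _ _ => (s + 1 : ℝ)) = (k + 1) * (k + 2) * (k + 3) / 6 := by
    rw [← triSum_medium]
    exact triSum_swap_fst k fun _ m _ => (m + 1 : ℝ)
  have h2 : triSum k (fun s _ _ => solution α β γ s) =
      α * triSum k (fun s _ _ => ((s : ℝ) + 1) * (harmonic s : ℝ)) +
        β * triSum k (fun _ _ _ => 1) + γ * triSum k (fun s _ _ => (s + 1 : ℝ)) := by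
    simp only [← triSum_mul_left, ← triSum_add, mul_one]
    rfl
  rw [recursiveCost_eq, h2, triSum_harmonic, triSum_one, h1, solution]
  push_cast
  field_simp
  ring

theorem averageComparisons_sub_recursiveCost (T : (n : ℕ) → DTree (n - 2)) (ρ : Arrangement)
    (k : ℕ) : averageComparisons T ρ (k + 2) - recursiveCost (averageComparisons T ρ) k =
      1 + (T (k + 2)).mean [] := by
  rw [averageComparisons_add_two]
  exact add_sub_cancel_right _ _

/-- The constants `4` and `-4` make the comparison function at most `0` for `n = 0` and `n = 1`,
with a partitioning cost of at most `1 + 3 k / 2` for `k + 2` keys. -/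
theorem le_averageComparisons (T : (n : ℕ) → DTree (n - 2)) (ρ : Arrangement) (n : ℕ) :
    1.8 * n * Real.log n - 4 * n ≤ averageComparisons T ρ n := by
  have h := le_of_sub_recursiveCost_le (u := solution 1.8 4 (-4)) (v := averageComparisons T ρ)
    (by rw [averageComparisons_of_lt_two T ρ (by omega)]; norm_num [solution])
    (by rw [averageComparisons_of_lt_two T ρ (by omega)]; norm_num [solution, harmonic_succ])
    (fun k => by
      rw [averageComparisons_sub_recursiveCost, solution_sub_recursiveCost]
      have h1 := le_mean (k := k) (T (k + 2))
      norm_num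
      linarith) n
  refine le_trans ?_ h
  have h1 : Real.log n ≤ harmonic n := by
    rcases n.eq_zero_or_pos with rfl | hn
    · simp
    · refine le_trans (Real.log_le_log (by positivity) ?_) (log_add_one_le_harmonic n)
      push_cast
      linarith
  have h2 : (0 : ℝ) ≤ harmonic n := (Real.log_natCast_nonneg n).trans h1
  have h3 := mul_le_mul_of_nonneg_left h1 (Nat.cast_nonneg (α := ℝ) n)
  rw [solution]
  norm_num
  linarith

/-- If partitioning `k + 2` keys costs at most `c k + D`, then quicksort costs at
most `(6 / 5) c n ln n` up to terms of lower order. -/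
theorem averageComparisons_le (T : (n : ℕ) → DTree (n - 2)) (ρ : Arrangement) {c D : ℝ}
    (hc : 0 ≤ c) (hD : 0 ≤ D) (hT : ∀ k : ℕ, 1 + (T (k + 2)).mean [] ≤ c * k + D) (n : ℕ) :
    averageComparisons T ρ n ≤ 6 / 5 * c * ((n + 1) * (1 + Real.log n)) + D * n := by
  have h := le_of_sub_recursiveCost_le (u := averageComparisons T ρ)
    (v := solution (6 / 5 * c) (-D / 2) (D / 2))
    (by rw [averageComparisons_of_lt_two T ρ (by omega)]; norm_num [solution]; linarith)
    (by
      rw [averageComparisons_of_lt_two T ρ (by omega)]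
      norm_num [solution, harmonic_succ]
      linarith)
    (fun k => by
      rw [averageComparisons_sub_recursiveCost, solution_sub_recursiveCost]
      have h1 := hT k
      linarith) n
  refine h.trans ?_
  have h1 := mul_le_mul_of_nonneg_left (harmonic_le_one_add_log n)
    (by positivity : 0 ≤ 6 / 5 * c * (n + 1))
  have h2 : 0 ≤ D * n := by positivity
  rw [solution]
  linarith

/-- A sample of size of order `n ^ (2 / 3)` grows without bound but is a vanishing part of
the input, so the cost of a partitioning step is at most `(3 / 2 + δ) k` up to a constant. -/
theorem exists_sample_bound (sz : ℕ → ℕ)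
    (hsz : ∀ n : ℕ, sz n = ⌊(n : ℝ) ^ (2 / 3 : ℝ)⌋₊ ∨ sz n = ⌈(n : ℝ) ^ (2 / 3 : ℝ)⌉₊)
    {δ : ℝ} (hδ : 0 < δ) : ∃ D : ℝ, 0 ≤ D ∧ ∀ k : ℕ,
      1 + (2 * sz (k + 2) + k * (3 / 2 + 1 / ((sz (k + 2) : ℝ) + 1))) ≤ (3 / 2 + δ) * k + D := by
  have hle (n : ℕ) : (sz n : ℝ) ≤ (n : ℝ) ^ (2 / 3 : ℝ) + 1 := by
    have h0 : (0 : ℝ) ≤ (n : ℝ) ^ (2 / 3 : ℝ) := by positivity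
    rcases hsz n with h | h <;> rw [h]
    · linarith [Nat.floor_le h0]
    · exact (Nat.ceil_lt_add_one h0).le
  have hge (n : ℕ) : (n : ℝ) ^ (2 / 3 : ℝ) ≤ (sz n : ℝ) + 1 := by
    rcases hsz n with h | h <;> rw [h]
    · exact (Nat.lt_floor_add_one _).le
    · linarith [Nat.le_ceil ((n : ℝ) ^ (2 / 3 : ℝ))]
  have hlim : Tendsto (fun n : ℕ => (n : ℝ) ^ (2 / 3 : ℝ)) atTop atTop :=
    (tendsto_rpow_atTop (by norm_num)).comp tendsto_natCast_atTop_atTop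
  have hlittle : ∀ᶠ n : ℕ in atTop, (n : ℝ) ^ (2 / 3 : ℝ) ≤ δ / 4 * n := by
    filter_upwards [((tendsto_rpow_atTop (show (0 : ℝ) < 1 / 3 by norm_num)).comp
      tendsto_natCast_atTop_atTop).eventually_ge_atTop (4 / δ), eventually_gt_atTop 0] with n h hn
    have hn' : (0 : ℝ) < n := Nat.cast_pos.2 hn
    have h1 : (n : ℝ) ^ (2 / 3 : ℝ) * (n : ℝ) ^ (1 / 3 : ℝ) = n := by
      rw [← Real.rpow_add hn']; norm_num
    have h2 := mul_le_mul_of_nonneg_left h (by positivity : 0 ≤ δ / 4 * (n : ℝ) ^ (2 / 3 : ℝ))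
    simp only [Function.comp_apply] at h2
    rw [mul_assoc _ _ ((n : ℝ) ^ (1 / 3 : ℝ)), h1] at h2
    refine le_trans (le_of_eq ?_) h2
    field_simp
  obtain ⟨N, hN⟩ := eventually_atTop.1 (hlittle.and (hlim.eventually_ge_atTop (2 / δ)))
  refine ⟨δ + 3 + ∑ k ∈ Finset.range N, (1 + (2 * sz (k + 2) +
    k * (3 / 2 + 1 / ((sz (k + 2) : ℝ) + 1)))), by positivity, fun k => ?_⟩
  rcases lt_or_ge k N with hk | hk
  · have h := Finset.single_le_sum (f := fun k : ℕ => 1 + (2 * sz (k + 2) +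
      k * (3 / 2 + 1 / ((sz (k + 2) : ℝ) + 1)))) (fun i _ => by positivity)
      (Finset.mem_range.2 hk)
    have h0 : 0 ≤ (3 / 2 + δ) * k := by positivity
    linarith
  · have hs : 0 ≤ ∑ k ∈ Finset.range N, (1 + (2 * (sz (k + 2) : ℝ) +
      k * (3 / 2 + 1 / ((sz (k + 2) : ℝ) + 1)))) := by positivity
    obtain ⟨h1, h2⟩ := hN (k + 2) (by omega)
    have h3 := hle (k + 2)
    have h4 : 1 / ((sz (k + 2) : ℝ) + 1) ≤ δ / 2 := by
      rw [div_le_iff₀ (by positivity)]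
      have := mul_le_mul_of_nonneg_left (h2.trans (hge (k + 2)))
        (show 0 ≤ δ / 2 by positivity)
      rwa [div_mul_div_comm, mul_comm δ, div_self (by positivity)] at this
    have h5 := mul_le_mul_of_nonneg_left h4 (Nat.cast_nonneg (α := ℝ) k)
    push_cast at h1 h3
    linarith

end DualPivot

theorem mainTheorem2 (sz : ℕ → ℕ)
    (hsz : ∀ n : ℕ, sz n = ⌊(n : ℝ) ^ (2 / 3 : ℝ)⌋₊ ∨ sz n = ⌈(n : ℝ) ^ (2 / 3 : ℝ)⌉₊) :
    (∀ (T : (n : ℕ) → DualPivot.DTree (n - 2)) (ρ : DualPivot.Arrangement),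
      (∀ n : ℕ, (T n).SamplesAfter (sz n) []) →
      (fun n : ℕ => DualPivot.averageComparisons T ρ n - 1.8 * n * Real.log n)
        =o[atTop] fun n : ℕ => (n : ℝ) * Real.log n) ∧
    (∀ ε : ℝ, 0 < ε → ∃ n₀ : ℕ, ∀ n : ℕ, n₀ ≤ n →
      ∀ (T : (n : ℕ) → DualPivot.DTree (n - 2)) (ρ : DualPivot.Arrangement),
        (1.8 - ε) * n * Real.log n ≤ DualPivot.averageComparisons T ρ n) := by
  have hlog : Tendsto (fun n : ℕ => Real.log n) atTop atTop :=
    Real.tendsto_log_atTop.comp tendsto_natCast_atTop_atTop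
  constructor
  · intro T ρ hT
    rw [isLittleO_iff]
    intro c hc
    obtain ⟨D, hD, hbound⟩ := DualPivot.exists_sample_bound sz hsz (δ := c / 2) (by positivity)
    have hmean (k : ℕ) : 1 + (T (k + 2)).mean [] ≤ (3 / 2 + c / 2) * k + D :=
      (add_le_add_right (DualPivot.mean_le (k := k) (T (k + 2)) (hT (k + 2))) 1).trans (hbound k)
    -- The terms of lower order are at most `(2 α + D) n + α log n` with `α = 9 / 5 + 3 c / 5`.
    set α : ℝ := 6 / 5 * (3 / 2 + c / 2) with hα
    have hα0 : 0 < α := by positivity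
    filter_upwards [hlog.eventually_ge_atTop (4 / c), hlog.eventually_ge_atTop 0,
      hlog.eventually_ge_atTop ((2 * α + D) / (c / 5)), eventually_ge_atTop 1,
      tendsto_natCast_atTop_atTop.eventually_ge_atTop (α / (c / 5))] with n h4 h0 h1 hn h2
    have hn' : (1 : ℝ) ≤ n := by exact_mod_cast hn
    have hlow := DualPivot.le_averageComparisons T ρ n
    have hup := DualPivot.averageComparisons_le T ρ (by positivity) hD hmean n
    rw [← hα] at hup
    rw [div_le_iff₀ (by positivity)] at h4 h1 h2
    rw [Real.norm_eq_abs, Real.norm_of_nonneg (by positivity), abs_le]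
    have e4 := mul_le_mul_of_nonneg_left h4 (by positivity : (0 : ℝ) ≤ n)
    have e1 := mul_le_mul_of_nonneg_left h1 (by positivity : (0 : ℝ) ≤ n)
    have e2 := mul_le_mul_of_nonneg_left h2 h0
    have e3 := mul_le_mul_of_nonneg_left hn' hα0.le
    constructor
    · linarith
    · have e5 : α * (n * Real.log n) = (9 / 5 + 3 / 5 * c) * (n * Real.log n) := by
        rw [hα]; ring
      linarith
  · intro ε hε
    obtain ⟨n₀, hn₀⟩ := eventually_atTop.1 (hlog.eventually_ge_atTop (4 / ε))
    refine ⟨n₀, fun n hn T ρ => le_trans ?_ (DualPivot.le_averageComparisons T ρ n)⟩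
    have h := hn₀ n hn
    rw [div_le_iff₀ hε] at h
    have := mul_le_mul_of_nonneg_left h (Nat.cast_nonneg (α := ℝ) n)
    linarith
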